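/- For a positive integer $d$ which is not a perfect square let $T(d)$ be the length of the minimal positive period of the simple continued fraction expansion of $\sqrt d$, and let $T(d)=0$ if $d$ is a perfect square. For real $x>1$ and $\alpha>0$ let \[ D(x,\alpha):=\{d\in\mathbb{N}\colon x<d\le 2x,\ T(d)>\alpha\sqrt d\}, \] and let $c_2:=\frac{8\sqrt2-4}{3}\log 2=1.6898\ldots$. Then there are functions $\varepsilon_1,\varepsilon_2\colon\mathbb{R}\to\mathbb{R}$, not depending on $\alpha$, with $\varepsilon_1(x)\to0$ and $\varepsilon_2(x)\to0$ as $x\to\infty$, such that for all $\alpha>0$ and all $x>1$ \[ \#D(x,\alpha)\le\frac{c_2+\varepsilon_1(x)}{\alpha}\,x \qquad\text{and}\qquad \#D(x,\alpha)\le\frac{47+\varepsilon_2(x)}{\alpha^2}\,x. \] -/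

import Mathlib

open Filter Topology

namespace SqrtPeriod

/-- `p` is a positive period of the (regular) simple continued fraction expansion
`[a₀; a₁, a₂, …]` of the real number `v`: from some index on, `aₙ₊ₚ = aₙ`. -/
def IsContFractPeriod (v : ℝ) (p : ℕ) : Prop :=
  0 < p ∧ ∃ N : ℕ, ∀ n ≥ N,
    (GenContFract.of v).partDens.get? (n + p) = (GenContFract.of v).partDens.get? n

/-- `T d`: the length of the minimal positive period of the simple continued fraction expansion
of `√d` if `d` is not a square, and `0` if `d` is a square. -/
noncomputable def T (d : ℕ) : ℕ :=
  if IsSquare d then 0 else sInf {p : ℕ | IsContFractPeriod (Real.sqrt (d : ℝ)) p}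

/-- `D x α`: the (finite) set of the natural numbers `d` in `(x, 2x]` with `T d > α √d`. -/
def D (x α : ℝ) : Set ℕ :=
  {d : ℕ | x < (d : ℝ) ∧ (d : ℝ) ≤ 2 * x ∧ α * Real.sqrt (d : ℝ) < (T d : ℝ)}

/-- The constant `c₂ = ((8√2 - 4) / 3) log 2`. -/
noncomputable def c₂ : ℝ := (8 * Real.sqrt 2 - 4) / 3 * Real.log 2

end SqrtPeriod

namespace SqrtPeriod

/-! ### The period is at most the number of reduced complete quotients -/

/-! Every complete quotient of `√d` after the first is a reduced `(P + √d) / Q` with `Q ∣ d - P ^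
2`, so by pigeonhole the period is at most the number of such pairs. Writing `d - P ^ 2 = Q * c` and
keeping the smaller of `Q` and `c` costs a factor 2: `T_le_two_mul_card_halfReduced` bounds `T d` by
twice the number `r(d)` of pairs `(a, b)` in `halfReduced d`. Both bounds then follow from Markov's
inequality at the threshold `α√x`, applied to moments of `r` over `(x, 2x]`.

First moment: for fixed `(a, b)` the admissible `d` form one residue class mod `b` inside an
interval, which gives its length over `b`, plus at most 1. The O(x) pairs make the rounding errors
O(x). The main terms are Riemann sums for the volume of `a² + bc ≤ y`, `0 ≤ a`, `0 < b ≤ c ≤ b +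
2a`, which is `(2/3) log 2 · y^(3/2)`; its increment from `y = x` to `y = 2x` is `(c₂ / 2) x^(3/2)`.
Summation over `b` is `sum_fiberLength_le`, over `a` is `sum_sliceArea_bounds`.

Second moment: for given `b`, the admissible `a` are distinct mod `b`, so `r(d)` is at most the sum
over `b ≤ √(2x)` of the number of square roots of `d` mod `b`. Squaring and summing over `d` leads
to pairs `i² ≡ j²` mod `g = gcd(b, b')`, counted through factorisations of `g`
(`card_sq_modEq_sq_mul_le`). The average of the divisor count of `gcd(b, b')` is at most `ζ(2)`, so
the total is O(x²). -/

theorem partDens_get?_eq_of_stream_eq {v : ℝ} {m n : ℕ}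
    (h : GenContFract.IntFractPair.stream v (m + 1) = GenContFract.IntFractPair.stream v (n + 1)) :
    (GenContFract.of v).partDens.get? m = (GenContFract.of v).partDens.get? n := by
  have key : ∀ k : ℕ, (GenContFract.of v).partDens.get? k =
      (GenContFract.IntFractPair.stream v (k + 1)).map (fun p => (p.b : ℝ)) := by
    intro k
    rw [← GenContFract.IntFractPair.get?_seq1_eq_succ_get?_stream]
    have hs : (GenContFract.of v).s = (GenContFract.IntFractPair.seq1 v).2.map
        fun p => (⟨1, (p.b : ℝ)⟩ : GenContFract.Pair ℝ) := rfl
    rw [GenContFract.partDens, hs, Stream'.Seq.map_get?, Stream'.Seq.map_get?, Option.map_map]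
    rfl
  rw [key, key, h]

/-- Each term of the stream is a function of the preceding one, so a single coincidence propagates
forever. -/
theorem stream_add_eq {v : ℝ} {m n : ℕ}
    (h : GenContFract.IntFractPair.stream v m = GenContFract.IntFractPair.stream v n) (k : ℕ) :
    GenContFract.IntFractPair.stream v (m + k) = GenContFract.IntFractPair.stream v (n + k) := by
  induction k with
  | zero => exact h
  | succ k ih =>
    rw [← add_assoc, ← add_assoc, GenContFract.IntFractPair.stream, ih]
    rfl

theorem isContFractPeriod_of_stream_eq {v : ℝ} {m n : ℕ} (hmn : m < n)
    (h : GenContFract.IntFractPair.stream v m = GenContFract.IntFractPair.stream v n) :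
    IsContFractPeriod v (n - m) := by
  refine ⟨by omega, m, fun k hk => partDens_get?_eq_of_stream_eq ?_⟩
  have := stream_add_eq h (k + 1 - m)
  rw [show m + (k + 1 - m) = k + 1 by omega] at this
  rw [this]
  congr 1
  omega

/-- The number `(P + √d) / Q` is a reduced quadratic irrationality with `Q ∣ d - P ^ 2`. -/
def IsReduced (d : ℕ) (x : ℤ × ℤ) : Prop :=
  x.2 ∣ (d : ℤ) - x.1 ^ 2 ∧ 0 < x.1 ∧ (x.1 : ℝ) < √d ∧ 0 < x.2 ∧
    √d - x.1 < x.2 ∧ (x.2 : ℝ) < √d + x.1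

/-- One step of the continued fraction algorithm. The hypotheses are weaker than `IsReduced` so that
they also cover `(P, Q) = (0, 1)`, that is `√d` itself. -/
theorem exists_isReduced_inv_fract {d : ℕ} (hd : ¬ IsSquare d) {P Q : ℤ} (hQ : 0 < Q)
    (hdvd : Q ∣ (d : ℤ) - P ^ 2) (hP : (P : ℝ) < √d) (hPQ : (Q : ℝ) ≤ P + √d) :
    Int.fract ((P + √d) / Q) ≠ 0 ∧ ∃ y : ℤ × ℤ, IsReduced d y ∧
      (Int.fract ((P + √d) / Q))⁻¹ = (y.1 + √d) / y.2 := by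
  have hs2 : √(d : ℝ) ^ 2 = d := Real.sq_sqrt (Nat.cast_nonneg d)
  have hirr : Irrational √(d : ℝ) := irrational_sqrt_natCast_iff.mpr hd
  set s := √(d : ℝ) with hs
  set ξ : ℝ := (P + s) / Q with hξ
  have hQr : (0 : ℝ) < Q := by exact_mod_cast hQ
  set A : ℤ := ⌊ξ⌋ with hA
  have hA1 : 1 ≤ A := by
    rw [hA, Int.le_floor, hξ, le_div_iff₀ hQr]
    push_cast
    linarith
  have hA1r : (1 : ℝ) ≤ A := by exact_mod_cast hA1
  set P' : ℤ := A * Q - P with hP'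
  have hP'r : (P' : ℝ) = A * Q - P := by rw [hP']; push_cast; ring
  have hfr : Int.fract ξ = (s - P') / Q := by
    rw [Int.fract, ← hA, hξ, hP'r]
    field_simp
    ring
  have hne : s - P' ≠ 0 := by
    intro h
    exact hirr ⟨(P' : ℚ), by push_cast; linarith⟩
  have hfr0 : Int.fract ξ ≠ 0 := by rw [hfr]; positivity
  have hpos : 0 < s - P' := by
    have h0 := lt_of_le_of_ne (Int.fract_nonneg ξ) (Ne.symm hfr0)
    rw [hfr] at h0
    exact (div_pos_iff_of_pos_right hQr).mp h0
  have hlt : s - P' < Q := by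
    have h1 := Int.fract_lt_one ξ
    rwa [hfr, div_lt_one hQr] at h1
  have hgt : (Q : ℝ) < s + P' := by
    rw [hP'r]
    nlinarith
  have hP'pos : (0 : ℝ) < P' := by linarith
  obtain ⟨Q', hQ'⟩ : Q ∣ (d : ℤ) - P' ^ 2 := by
    have : (d : ℤ) - P' ^ 2 = ((d : ℤ) - P ^ 2) - Q * (A * (A * Q - 2 * P)) := by
      rw [hP']; ring
    rw [this]
    exact dvd_sub hdvd (dvd_mul_right _ _)
  have hQ'r : (s - P') * (s + P') = Q * Q' := by
    have : ((d : ℤ) - P' ^ 2 : ℝ) = Q * Q' := by exact_mod_cast hQ'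
    push_cast at this
    nlinarith
  have hQ'pos : (0 : ℝ) < Q' := by
    have : 0 < (Q : ℝ) * Q' := by rw [← hQ'r]; exact mul_pos hpos (by linarith)
    exact (mul_pos_iff_of_pos_left hQr).mp this
  refine ⟨hfr0, (P', Q'), ⟨⟨Q, by rw [hQ']; ring⟩, by exact_mod_cast hP'pos, by linarith,
    by exact_mod_cast hQ'pos, ?_, ?_⟩, ?_⟩
  -- Both remaining inequalities come from `(s - P') (s + P') = Q Q'` together with `s - P' < Q < s
  -- + P'`.
  · by_contra! h
    dsimp only at h
    nlinarith
  · by_contra! h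
    dsimp only at h
    nlinarith
  · rw [hfr, inv_div, div_eq_div_iff hne hQ'pos.ne']
    dsimp only
    linarith

theorem exists_isReduced_stream {d : ℕ} (hd : ¬ IsSquare d) (n : ℕ) :
    ∃ y : ℤ × ℤ, IsReduced d y ∧ GenContFract.IntFractPair.stream √(d : ℝ) (n + 1) =
      some (GenContFract.IntFractPair.of ((y.1 + √d) / y.2)) := by
  have hd1 : 1 ≤ d := by
    rcases Nat.eq_zero_or_pos d with h | h
    · exact absurd ⟨0, by simpa using h⟩ hd
    · exact h
  have hs1 : (1 : ℝ) ≤ √d := by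
    rw [Real.one_le_sqrt]; exact_mod_cast hd1
  induction n with
  | zero =>
    obtain ⟨h0, y, hy, hy'⟩ := exists_isReduced_inv_fract hd (P := 0) (Q := 1) one_pos
      (one_dvd _) (by push_cast; linarith) (by push_cast; linarith)
    refine ⟨y, hy, ?_⟩
    have he : (((0 : ℤ) : ℝ) + √d) / ((1 : ℤ) : ℝ) = √d := by simp
    rw [he] at h0 hy'
    rw [GenContFract.IntFractPair.stream_succ_of_some
      (GenContFract.IntFractPair.stream_zero _) h0, ← hy']
    rfl
  | succ n ih =>
    obtain ⟨y, ⟨h1, h2, h3, h4, h5, h6⟩, hst⟩ := ih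
    obtain ⟨h0, z, hz, hz'⟩ := exists_isReduced_inv_fract hd h4 h1 h3 (by linarith)
    refine ⟨z, hz, ?_⟩
    rw [GenContFract.IntFractPair.stream_succ_of_some hst h0, ← hz']
    rfl

/-- Pairs `(a, b)` with `d = a ^ 2 + b c` for some `b ≤ c < b + 2 a`. -/
def halfReduced (d : ℕ) : Finset (ℕ × ℕ) :=
  (Finset.range (d + 1) ×ˢ Finset.range (d + 1)).filter fun x =>
    0 < x.2 ∧ x.1 ^ 2 + x.2 ^ 2 ≤ d ∧ d < (x.1 + x.2) ^ 2 ∧ d ≡ x.1 ^ 2 [MOD x.2]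

theorem mem_halfReduced {d a b : ℕ} : (a, b) ∈ halfReduced d ↔
    0 < b ∧ a ^ 2 + b ^ 2 ≤ d ∧ d < (a + b) ^ 2 ∧ d ≡ a ^ 2 [MOD b] := by
  simp only [halfReduced, Finset.mem_filter, Finset.mem_product, Finset.mem_range,
    and_iff_right_iff_imp]
  rintro ⟨-, h, -⟩
  constructor <;> nlinarith

/-- The reducedness inequalities are symmetric in `Q` and the cofactor `c = (d - P ^ 2) / Q`, so `P`
can be paired with the smaller of the two; the alternatives record which one was kept. -/
theorem exists_halfReduced_of_isReduced {d : ℕ} {x : ℤ × ℤ} (hx : IsReduced d x) :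
    ∃ y ∈ halfReduced d, x = ((y.1 : ℤ), (y.2 : ℤ)) ∨
      x = ((y.1 : ℤ), ((d : ℤ) - (y.1 : ℤ) ^ 2) / (y.2 : ℤ)) := by
  obtain ⟨P, Q⟩ := x
  obtain ⟨⟨c, hc⟩, h2, h3, h4, h5, h6⟩ := hx
  dsimp only at *
  have hs2 : √(d : ℝ) ^ 2 = d := Real.sq_sqrt (Nat.cast_nonneg d)
  have hs0 := Real.sqrt_nonneg (d : ℝ)
  set s := √(d : ℝ)
  have h2r : (0 : ℝ) < P := by exact_mod_cast h2
  have h4r : (0 : ℝ) < Q := by exact_mod_cast h4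
  have hPd : P ^ 2 < (d : ℤ) := by
    have : (P : ℝ) ^ 2 < (d : ℝ) := by nlinarith
    exact_mod_cast this
  have hlt : (d : ℤ) < (P + Q) ^ 2 := by
    have : (d : ℝ) < ((P : ℝ) + Q) ^ 2 := by nlinarith
    exact_mod_cast this
  have hgt : (Q - P) ^ 2 < (d : ℤ) := by
    have : ((Q : ℝ) - P) ^ 2 < (d : ℝ) := by
      rw [← hs2]
      exact sq_lt_sq' (by linarith) (by linarith)
    exact_mod_cast this
  have hc0 : 0 < c := by
    have : 0 < Q * c := by linarith
    exact (mul_pos_iff_of_pos_left h4).mp this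
  lift P to ℕ using h2.le
  lift Q to ℕ using h4.le
  lift c to ℕ using hc0.le
  have hcongr : ∀ q : ℕ, (q : ℤ) ∣ (d : ℤ) - (P : ℤ) ^ 2 → d ≡ P ^ 2 [MOD q] := by
    intro q hq
    refine (Nat.modEq_iff_dvd.mpr ?_).symm
    push_cast
    exact hq
  rcases le_total Q c with hQc | hcQ
  · refine ⟨(P, Q), mem_halfReduced.mpr ⟨by exact_mod_cast h4, ?_, by exact_mod_cast hlt,
      hcongr _ ⟨c, hc⟩⟩, Or.inl rfl⟩
    zify at hQc ⊢
    nlinarith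
  · refine ⟨(P, c), mem_halfReduced.mpr ⟨by exact_mod_cast hc0, ?_, ?_,
      hcongr _ ⟨Q, by rw [hc]; ring⟩⟩, Or.inr ?_⟩
    · zify at hcQ ⊢
      nlinarith
    · zify at hcQ ⊢
      have : (Q : ℤ) < 2 * P + c := by
        by_contra! h
        nlinarith
      nlinarith
    · dsimp only
      rw [hc, Int.mul_ediv_cancel _ hc0.ne']

theorem T_le_two_mul_card_halfReduced (d : ℕ) : T d ≤ 2 * (halfReduced d).card := by
  classical
  unfold T
  split_ifs with hd
  · exact Nat.zero_le _
  set S : Finset (ℤ × ℤ) :=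
    (halfReduced d).image (fun y => ((y.1 : ℤ), (y.2 : ℤ))) ∪
      (halfReduced d).image (fun y => ((y.1 : ℤ), ((d : ℤ) - (y.1 : ℤ) ^ 2) / (y.2 : ℤ))) with hS
  have hScard : S.card ≤ 2 * (halfReduced d).card := by
    rw [two_mul]
    exact (Finset.card_union_le _ _).trans
      (add_le_add Finset.card_image_le Finset.card_image_le)
  choose f hf hf' using exists_isReduced_stream hd
  have hfS : ∀ n ∈ Finset.range (S.card + 1), f n ∈ S := by
    intro n _
    obtain ⟨y, hy, h | h⟩ := exists_halfReduced_of_isReduced (hf n)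
    · exact Finset.mem_union_left _ (Finset.mem_image.mpr ⟨y, hy, h.symm⟩)
    · exact Finset.mem_union_right _ (Finset.mem_image.mpr ⟨y, hy, h.symm⟩)
  -- Among `S.card + 1` consecutive complete quotients two coincide, at distance at most `S.card`.
  obtain ⟨m, hm, n, hn, hne, heq⟩ :=
    Finset.exists_ne_map_eq_of_card_lt_of_maps_to (by simp) hfS
  wlog hlt : m < n generalizing m n
  · exact this n hn m hm hne.symm heq.symm (by omega)
  have hper : IsContFractPeriod √(d : ℝ) (n + 1 - (m + 1)) :=
    isContFractPeriod_of_stream_eq (by omega) (by rw [hf', hf', heq])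
  refine (Nat.sInf_le hper).trans (le_trans ?_ hScard)
  rw [Finset.mem_range] at hn
  omega

/-! ### Lattice points under a quadric -/

theorem card_le_of_modEq {S : Finset ℕ} {b : ℕ} (hb : 0 < b) {l h : ℝ} (hlh : l ≤ h)
    (hS : ∀ d ∈ S, l ≤ (d : ℝ) ∧ (d : ℝ) ≤ h) (hmod : ∀ d ∈ S, ∀ e ∈ S, d ≡ e [MOD b]) :
    (S.card : ℝ) ≤ (h - l) / b + 1 := by
  have hbr : (0 : ℝ) < b := by exact_mod_cast hb
  have hnn : 0 ≤ (h - l) / b := div_nonneg (by linarith) hbr.le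
  rcases S.eq_empty_or_nonempty with rfl | hne
  · simp only [Finset.card_empty, Nat.cast_zero]
    linarith
  set m := S.min' hne with hm
  have hmS : m ∈ S := S.min'_mem hne
  have hdiv : ∀ d ∈ S, ∃ k, d = m + b * k := by
    intro d hd
    have hmd : m ≤ d := S.min'_le d hd
    obtain ⟨k, hk⟩ := (Nat.modEq_iff_dvd' hmd).mp (hmod m hmS d hd)
    exact ⟨k, by omega⟩
  have hcard : S.card ≤ (Finset.range (⌊(h - l) / b⌋₊ + 1)).card := by
    refine Finset.card_le_card_of_injOn (fun d => (d - m) / b) ?_ ?_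
    · intro d hd
      obtain ⟨k, rfl⟩ := hdiv d hd
      simp only [Finset.coe_range, Set.mem_Iio, add_tsub_cancel_left, Nat.mul_div_cancel_left _ hb]
      rw [Nat.lt_succ_iff, Nat.le_floor_iff hnn, le_div_iff₀ hbr]
      have h1 := (hS _ hd).2
      have h2 := (hS _ hmS).1
      push_cast at h1
      linarith
    · intro d hd e he hde
      obtain ⟨k, rfl⟩ := hdiv d hd
      obtain ⟨j, rfl⟩ := hdiv e he
      simp only [add_tsub_cancel_left, Nat.mul_div_cancel_left _ hb] at hde
      rw [hde]
  rw [Finset.card_range] at hcard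
  calc (S.card : ℝ) ≤ ((⌊(h - l) / b⌋₊ + 1 : ℕ) : ℝ) := by exact_mod_cast hcard
    _ ≤ (h - l) / b + 1 := by
      push_cast
      gcongr
      exact Nat.floor_le hnn

/-- The length of the set of real `c` with `b ≤ c ≤ b + 2 a` and `a ^ 2 + b c ≤ y`. -/
noncomputable def fiberLength (y a b : ℝ) : ℝ := min (2 * a) (max 0 ((y - a ^ 2 - b ^ 2) / b))

/-- The limit of the sums of `fiberLength (X ^ 2) t b` over `b`. -/
noncomputable def sliceArea (X t : ℝ) : ℝ :=
  t * (X - t) + ((X - t) * ((X + t) * Real.log (X + t)) -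
    (X + t) * ((X - t) * Real.log (X - t))) / 2

theorem card_filter_halfReduced_le {x : ℝ} (hx : 0 ≤ x) (a : ℕ) {b : ℕ} (hb : 0 < b) :
    ((((Finset.Ioc ⌊x⌋₊ ⌊2 * x⌋₊).filter fun d => (a, b) ∈ halfReduced d).card : ℕ) : ℝ) ≤
      fiberLength (2 * x) a b - fiberLength x a b + 1 := by
  have hbr : (0 : ℝ) < b := by exact_mod_cast hb
  have har : (0 : ℝ) ≤ a := Nat.cast_nonneg a
  set S := (Finset.Ioc ⌊x⌋₊ ⌊2 * x⌋₊).filter fun d => (a, b) ∈ halfReduced d with hSdef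
  have hmono : fiberLength x a b ≤ fiberLength (2 * x) a b := by
    unfold fiberLength
    gcongr
    linarith
  have hmem : ∀ d ∈ S, max x ((a : ℝ) ^ 2 + b ^ 2) ≤ d ∧
      (d : ℝ) ≤ min (2 * x) (((a : ℝ) + b) ^ 2) := by
    intro d hd
    rw [hSdef, Finset.mem_filter, Finset.mem_Ioc, mem_halfReduced] at hd
    obtain ⟨⟨h1, h2⟩, -, h3, h4, -⟩ := hd
    refine ⟨max_le ((Nat.floor_lt hx).mp h1).le (by exact_mod_cast h3),
      le_min ((Nat.le_floor_iff (by linarith)).mp h2) (by exact_mod_cast h4.le)⟩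
  rcases S.eq_empty_or_nonempty with h | ⟨d₀, hd₀⟩
  · rw [h]
    simp only [Finset.card_empty, Nat.cast_zero]
    linarith
  refine (card_le_of_modEq hb ((hmem d₀ hd₀).1.trans (hmem d₀ hd₀).2) hmem ?_).trans ?_
  · intro d hd e he
    exact (mem_halfReduced.mp (Finset.mem_filter.mp hd).2).2.2.2.trans
      (mem_halfReduced.mp (Finset.mem_filter.mp he).2).2.2.2.symm
  · gcongr
    rw [div_le_iff₀ hbr]
    have hmul : ∀ y : ℝ, fiberLength y a b * b = min (2 * (a : ℝ) * b) (max 0 (y - a ^ 2 - b ^ 2)) := by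
      intro y
      rw [fiberLength, min_mul_of_nonneg _ _ hbr.le, max_mul_of_nonneg _ _ hbr.le, zero_mul,
        div_mul_cancel₀ _ hbr.ne']
    -- After multiplication by `b` everything is piecewise linear in `x`, `a²`, `b²` and `ab`. The
    -- member `d₀` guarantees that the interval is nonempty, without which the comparison of its
    -- length would fail.
    rw [sub_mul, hmul, hmul]
    have h1 := (hmem d₀ hd₀).1.trans (hmem d₀ hd₀).2
    have hab : 0 ≤ (a : ℝ) * b := by positivity
    have hsq : ((a : ℝ) + b) ^ 2 = a ^ 2 + b ^ 2 + 2 * a * b := by ring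
    rw [hsq] at h1 ⊢
    generalize (a : ℝ) ^ 2 = A at *
    generalize (b : ℝ) ^ 2 = B at *
    simp only [max_le_iff, le_min_iff] at h1
    obtain ⟨⟨h11, h12⟩, h13, h14⟩ := h1
    rw [max_eq_right (show 0 ≤ 2 * x - A - B by linarith)]
    rcases le_total x (A + B) with h2 | h2
    · rw [max_eq_right h2, max_eq_left (by linarith),
        min_eq_right (show 0 ≤ 2 * (a : ℝ) * b by linarith)]
      rcases le_total (2 * x) (A + B + 2 * a * b) with h3 | h3
      · rw [min_eq_left h3, min_eq_right (by linarith)]; linarith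
      · rw [min_eq_right h3, min_eq_left (by linarith)]; linarith
    · rw [max_eq_left h2, max_eq_right (by linarith), min_eq_right (show x - A - B ≤ _ by linarith)]
      rcases le_total (2 * x) (A + B + 2 * a * b) with h3 | h3
      · rw [min_eq_left h3, min_eq_right (by linarith)]; linarith
      · rw [min_eq_right h3, min_eq_left (by linarith)]; linarith

theorem sum_card_halfReduced_le {x : ℝ} (hx : 0 ≤ x) {M : ℕ} (hM : √(2 * x) ≤ M) :
    ∑ d ∈ Finset.Ioc ⌊x⌋₊ ⌊2 * x⌋₊, ((halfReduced d).card : ℝ) ≤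
      ∑ a ∈ Finset.range (M + 1), ∑ i ∈ Finset.range M, fiberLength (2 * x) a ((i + 1 : ℕ) : ℝ) -
      ∑ a ∈ Finset.range (M + 1), ∑ i ∈ Finset.range M, fiberLength x a ((i + 1 : ℕ) : ℝ) +
      (M + 1) * M := by
  set t := Finset.range (M + 1) ×ˢ Finset.range M with ht
  have h1 : ∀ d ∈ Finset.Ioc ⌊x⌋₊ ⌊2 * x⌋₊,
      (halfReduced d).card ≤ (t.filter fun p => (p.1, p.2 + 1) ∈ halfReduced d).card := by
    intro d hd
    have hdx : (d : ℝ) ≤ 2 * x := (Nat.le_floor_iff (by linarith)).mp (Finset.mem_Ioc.mp hd).2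
    have hdM : d ≤ M ^ 2 := by
      have h : (d : ℝ) ≤ (M : ℝ) ^ 2 := hdx.trans ((Real.sqrt_le_left (Nat.cast_nonneg M)).mp hM)
      exact_mod_cast h
    refine Finset.card_le_card_of_injOn (fun p => (p.1, p.2 - 1)) ?_ ?_
    · rintro ⟨a, b⟩ hp
      have hp' := mem_halfReduced.mp hp
      have ha : a ≤ M := by nlinarith
      have hb : b ≤ M := by nlinarith
      have hb' : b - 1 + 1 = b := by omega
      rw [Finset.mem_coe, Finset.mem_filter, ht, Finset.mem_product, Finset.mem_range,
        Finset.mem_range]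
      dsimp only
      rw [hb']
      exact ⟨⟨by omega, by omega⟩, hp⟩
    · rintro ⟨a, b⟩ hp ⟨a', b'⟩ hp' heq
      have h2 := (mem_halfReduced.mp hp).1
      have h3 := (mem_halfReduced.mp hp').1
      simp only [Prod.mk.injEq] at heq ⊢
      omega
  have h2 : ∑ d ∈ Finset.Ioc ⌊x⌋₊ ⌊2 * x⌋₊, (halfReduced d).card ≤
      ∑ p ∈ t, ((Finset.Ioc ⌊x⌋₊ ⌊2 * x⌋₊).filter fun d => (p.1, p.2 + 1) ∈ halfReduced d).card := by
    refine (Finset.sum_le_sum h1).trans_eq ?_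
    exact Finset.sum_card_bipartiteAbove_eq_sum_card_bipartiteBelow
      (fun d (p : ℕ × ℕ) => (p.1, p.2 + 1) ∈ halfReduced d)
  calc ∑ d ∈ Finset.Ioc ⌊x⌋₊ ⌊2 * x⌋₊, ((halfReduced d).card : ℝ)
      ≤ ∑ p ∈ t, ((((Finset.Ioc ⌊x⌋₊ ⌊2 * x⌋₊).filter
          fun d => (p.1, p.2 + 1) ∈ halfReduced d).card : ℕ) : ℝ) := by exact_mod_cast h2
    _ ≤ ∑ p ∈ t, (fiberLength (2 * x) p.1 ((p.2 + 1 : ℕ) : ℝ) -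
          fiberLength x p.1 ((p.2 + 1 : ℕ) : ℝ) + 1) :=
        Finset.sum_le_sum fun p _ => card_filter_halfReduced_le hx p.1 (Nat.succ_pos _)
    _ = _ := by
      rw [ht, Finset.sum_product, ← Finset.sum_sub_distrib]
      simp_rw [Finset.sum_add_distrib, ← Finset.sum_sub_distrib]
      simp

/-! ### The sum over `b` -/

theorem fiberLength_eq_zero {X a b : ℝ} (ha : 0 ≤ a) (hX : 0 ≤ X) (hb : 0 < b) (h : X ≤ a) :
    fiberLength (X ^ 2) a b = 0 := by
  rw [fiberLength, max_eq_left, min_eq_right (by linarith)]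
  exact div_nonpos_of_nonpos_of_nonneg (by nlinarith) hb.le

/-- A version of `fiberLength` that is antitone up to `b = 0`. -/
noncomputable def fiberLength₀ (X a b : ℝ) : ℝ :=
  if b ≤ X - a then 2 * a else max 0 ((X ^ 2 - a ^ 2) / b - b)

theorem fiberLength_eq {X a b : ℝ} (ha : 0 ≤ a) (hb : 0 < b) (h : a < X) :
    fiberLength (X ^ 2) a b = fiberLength₀ X a b := by
  have hq : (X ^ 2 - a ^ 2 - b ^ 2) / b = (X ^ 2 - a ^ 2) / b - b := by field_simp
  rw [fiberLength, fiberLength₀]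
  split_ifs with hbX
  · refine min_eq_left (le_max_of_le_right ?_)
    rw [le_div_iff₀ hb]
    nlinarith
  · rw [hq]
    refine min_eq_right (max_le (by linarith) ?_)
    -- The cap `2a` is met exactly when `X² = (a + b)²`, hence the cut at `b = X - a`.
    rw [← hq, div_le_iff₀ hb]
    nlinarith

theorem antitoneOn_fiberLength₀ {X a : ℝ} (ha : 0 ≤ a) (h : a < X) (M : ℝ) :
    AntitoneOn (fiberLength₀ X a) (Set.Icc 0 M) := by
  rintro s ⟨hs, -⟩ t ⟨ht, -⟩ hst
  unfold fiberLength₀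
  split_ifs with h1 h2 h2
  · exact le_rfl
  · linarith
  · have ht0 : 0 < t := by linarith
    refine max_le (by linarith) ?_
    rw [tsub_le_iff_right, div_le_iff₀ ht0]
    nlinarith
  · have hs0 : 0 < s := by linarith
    have : 0 ≤ X ^ 2 - a ^ 2 := by nlinarith
    gcongr

/-- The integrand is the constant `2a` up to `X - a`, then `(X² - a²) / b - b` up to its zero `w =
√(X² - a²)`, then 0. -/
theorem integral_fiberLength₀ {X a M : ℝ} (ha : 0 ≤ a) (h : a < X) (hM : X ≤ M) :
    ∫ b in (0 : ℝ)..M, fiberLength₀ X a b = sliceArea X a := by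
  set w := √(X ^ 2 - a ^ 2) with hw
  have hXa : 0 < X - a := by linarith
  have hpos : 0 < X ^ 2 - a ^ 2 := by nlinarith
  have hw2 : w ^ 2 = X ^ 2 - a ^ 2 := Real.sq_sqrt hpos.le
  have hw0 : 0 ≤ w := Real.sqrt_nonneg _
  have h1w : X - a ≤ w := Real.le_sqrt_of_sq_le (by nlinarith)
  have hw0' : 0 < w := by linarith
  have hwX : w ≤ X := by nlinarith
  have hint : ∀ u v, 0 ≤ u → 0 ≤ v →
      IntervalIntegrable (fiberLength₀ X a) MeasureTheory.volume u v := by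
    intro u v hu hv
    refine ((antitoneOn_fiberLength₀ ha h (max u v)).mono ?_).intervalIntegrable
    intro z hz
    exact ⟨(le_min hu hv).trans hz.1, hz.2⟩
  have i1 : ∫ b in (0 : ℝ)..(X - a), fiberLength₀ X a b = 2 * a * (X - a) := by
    rw [intervalIntegral.integral_congr (g := fun _ => 2 * a)]
    · rw [intervalIntegral.integral_const, smul_eq_mul]; ring
    · intro b hb
      rw [Set.uIcc_of_le hXa.le] at hb
      exact if_pos hb.2
  have i2 : ∫ b in (X - a)..w, fiberLength₀ X a b =
      (X ^ 2 - a ^ 2) * (Real.log w - Real.log (X - a)) - (w ^ 2 - (X - a) ^ 2) / 2 := by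
    rw [intervalIntegral.integral_congr (g := fun b => (X ^ 2 - a ^ 2) * b⁻¹ - b)]
    · rw [intervalIntegral.integral_sub, intervalIntegral.integral_const_mul,
        integral_inv_of_pos hXa hw0', integral_id, Real.log_div hw0'.ne' hXa.ne']
      · refine (intervalIntegral.intervalIntegrable_inv ?_ continuousOn_id).const_mul _
        intro z hz
        rw [Set.uIcc_of_le h1w] at hz
        exact (hXa.trans_le hz.1).ne'
      · exact intervalIntegral.intervalIntegrable_id
    · intro b hb
      rw [Set.uIcc_of_le h1w] at hb
      have hb0 : 0 < b := by linarith [hb.1]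
      dsimp only [fiberLength₀]
      split_ifs with hbX
      · have : b = X - a := le_antisymm hbX hb.1
        rw [this]
        field_simp
        ring
      · rw [max_eq_right, div_eq_mul_inv]
        rw [sub_nonneg, le_div_iff₀ hb0]
        nlinarith [hb.2]
  have i3 : ∫ b in w..M, fiberLength₀ X a b = 0 := by
    rw [intervalIntegral.integral_congr (g := fun _ => 0)]
    · simp
    · intro b hb
      rw [Set.uIcc_of_le (by linarith)] at hb
      have hb0 : 0 < b := by linarith [hb.1]
      dsimp only [fiberLength₀]
      split_ifs with hbX
      · have h1 : w = X - a := le_antisymm (hb.1.trans hbX) h1w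
        have h2 : 2 * a * (X - a) = 0 := by rw [h1] at hw2; nlinarith
        rcases mul_eq_zero.mp h2 with h3 | h3
        · exact h3
        · linarith
      · rw [max_eq_left]
        rw [sub_nonpos, div_le_iff₀ hb0]
        nlinarith [hb.1]
  rw [← intervalIntegral.integral_add_adjacent_intervals (hint 0 w le_rfl hw0)
      (hint w M hw0 (by linarith)),
    ← intervalIntegral.integral_add_adjacent_intervals (hint 0 (X - a) le_rfl hXa.le)
      (hint (X - a) w hXa.le hw0), i1, i2, i3]
  have hlw : Real.log w = (Real.log (X + a) + Real.log (X - a)) / 2 := by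
    rw [hw, Real.log_sqrt hpos.le, ← Real.log_mul (by linarith) hXa.ne']
    congr 2
    ring
  rw [hlw, hw2, sliceArea]
  ring

/-- Left and right Riemann sums of an antitone function enclose its integral; the loss `2a` is the
value at `b = 0`. -/
theorem sum_fiberLength_le {X a : ℝ} (ha : 0 ≤ a) (h : a ≤ X) {M : ℕ} (hM : X ≤ M) :
    ∑ i ∈ Finset.range M, fiberLength (X ^ 2) a ((i + 1 : ℕ) : ℝ) ≤ sliceArea X a ∧
    sliceArea X a - 2 * a ≤ ∑ i ∈ Finset.range M, fiberLength (X ^ 2) a ((i + 1 : ℕ) : ℝ) := by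
  rcases h.eq_or_lt with rfl | h
  · have h0 : ∑ i ∈ Finset.range M, fiberLength (a ^ 2) a ((i + 1 : ℕ) : ℝ) = 0 :=
      Finset.sum_eq_zero fun i _ => fiberLength_eq_zero ha ha (by positivity) le_rfl
    rw [h0]
    simp only [sliceArea, sub_self]
    constructor <;> linarith
  · have he : ∑ i ∈ Finset.range M, fiberLength (X ^ 2) a ((i + 1 : ℕ) : ℝ) =
        ∑ i ∈ Finset.range M, fiberLength₀ X a ((i + 1 : ℕ) : ℝ) :=
      Finset.sum_congr rfl fun i _ => fiberLength_eq ha (by positivity) h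
    have hanti : AntitoneOn (fiberLength₀ X a) (Set.Icc ((0 : ℕ) : ℝ) M) := by
      simpa using antitoneOn_fiberLength₀ ha h M
    have h1 := hanti.sum_le_integral_Ico (Nat.zero_le M)
    have h2 := hanti.integral_le_sum_Ico (Nat.zero_le M)
    rw [Nat.cast_zero, integral_fiberLength₀ ha h hM, Nat.Ico_zero_eq_range] at h1 h2
    rw [he]
    refine ⟨h1, ?_⟩
    have h3 : ∑ i ∈ Finset.range M, fiberLength₀ X a (i : ℝ) ≤
        ∑ i ∈ Finset.range (M + 1), fiberLength₀ X a (i : ℝ) := by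
      refine Finset.sum_le_sum_of_subset_of_nonneg (by simp) fun i _ _ => ?_
      unfold fiberLength₀
      split_ifs
      · linarith
      · exact le_max_left _ _
    rw [Finset.sum_range_succ'] at h3
    have h4 : fiberLength₀ X a ((0 : ℕ) : ℝ) = 2 * a := if_pos (by simp; linarith)
    linarith

/-! ### The sum over `a` -/

/-- `u * log u` is continuous at 0, so grouping the logarithms this way extends continuity to `t =
X`. -/
theorem continuous_sliceArea (X : ℝ) : Continuous (sliceArea X) := by
  have h1 : Continuous fun t : ℝ => (X + t) * Real.log (X + t) :=
    Real.continuous_mul_log.comp (continuous_const.add continuous_id)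
  have h2 : Continuous fun t : ℝ => (X - t) * Real.log (X - t) :=
    Real.continuous_mul_log.comp (continuous_const.sub continuous_id)
  unfold sliceArea
  fun_prop

theorem sliceArea_nonneg {X t : ℝ} (ht : 0 ≤ t) (h : t ≤ X) : 0 ≤ sliceArea X t := by
  rcases h.eq_or_lt with rfl | h
  · simp [sliceArea]
  have : Real.log (X - t) ≤ Real.log (X + t) := Real.log_le_log (by linarith) (by linarith)
  have h2 : sliceArea X t = t * (X - t) +
      (X - t) * (X + t) * (Real.log (X + t) - Real.log (X - t)) / 2 := by
    unfold sliceArea; ring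
  rw [h2]
  have h3 : 0 ≤ X - t := by linarith
  have h4 : 0 ≤ X + t := by linarith
  have h5 : 0 ≤ Real.log (X + t) - Real.log (X - t) := by linarith
  positivity

theorem sliceArea_le {X t : ℝ} (ht : 0 ≤ t) (h : t ≤ X) : sliceArea X t ≤ 3 * X ^ 2 := by
  rcases h.eq_or_lt with rfl | h
  · simp [sliceArea]; positivity
  have h3 : 0 < X - t := by linarith
  have h4 : 0 < X + t := by linarith
  have h5 : Real.log (X + t) - Real.log (X - t) ≤ 2 * t / (X - t) := by
    rw [← Real.log_div h4.ne' h3.ne']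
    refine (Real.log_le_sub_one_of_pos (by positivity)).trans_eq ?_
    field_simp
    ring
  have h6 : (X - t) * (Real.log (X + t) - Real.log (X - t)) ≤ 2 * t := by
    rwa [le_div_iff₀ h3, mul_comm] at h5
  have h2 : sliceArea X t = t * (X - t) +
      (X + t) * ((X - t) * (Real.log (X + t) - Real.log (X - t))) / 2 := by
    unfold sliceArea; ring
  have h7 := mul_le_mul_of_nonneg_left h6 h4.le
  rw [h2]
  nlinarith

theorem integral_sliceArea {X : ℝ} (hX : 0 < X) :
    ∫ t in (0 : ℝ)..X, sliceArea X t = 2 / 3 * Real.log 2 * X ^ 3 := by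
  -- An antiderivative of `w (2X - w) log w / 2`. The substitutions `w = X + t` and `w = X - t` both
  -- turn `w (2X - w)` into `X² - t²`, so one `K` serves both logarithms.
  set K : ℝ → ℝ := fun w =>
    ((X * w - w ^ 2 / 3) * (w * Real.log w) - X * w ^ 2 / 2 + w ^ 3 / 9) / 2 with hK
  have hKc : Continuous K := by
    have := Real.continuous_mul_log
    rw [hK]
    fun_prop
  have hKd : ∀ w, 0 < w → HasDerivAt K (w * (2 * X - w) * Real.log w / 2) w := by
    intro w hw
    have h1 : HasDerivAt (fun w : ℝ => X * w - w ^ 2 / 3) (X - 2 * w / 3) w := by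
      refine (((hasDerivAt_id w).const_mul X).sub
        (((hasDerivAt_id w).pow 2).div_const 3)).congr_deriv ?_
      simp
    have h2 := Real.hasDerivAt_mul_log hw.ne'
    have h3 : HasDerivAt (fun w : ℝ => X * w ^ 2 / 2) (X * w) w := by
      refine ((((hasDerivAt_id w).pow 2).const_mul X).div_const 2).congr_deriv ?_
      simp; ring
    have h4 : HasDerivAt (fun w : ℝ => w ^ 3 / 9) (w ^ 2 / 3) w := by
      refine (((hasDerivAt_id w).pow 3).div_const 9).congr_deriv ?_
      simp; ring
    refine ((((h1.mul h2).sub h3).add h4).div_const 2).congr_deriv ?_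
    ring
  have hF := intervalIntegral.integral_eq_sub_of_hasDerivAt_of_le
    (f := fun t => X * t ^ 2 / 2 - t ^ 3 / 3 + K (X + t) + K (X - t)) (f' := sliceArea X) hX.le
    (by fun_prop) (fun t ht => ?_) ((continuous_sliceArea X).intervalIntegrable _ _)
  · rw [hF, hK]
    have : Real.log (X + X) = Real.log 2 + Real.log X := by
      rw [← two_mul, Real.log_mul two_ne_zero hX.ne']
    simp only [this, sub_self, add_zero, sub_zero]
    ring
  · have hp := (hKd (X + t) (by linarith [ht.1])).comp t ((hasDerivAt_id t).const_add X)
    have hm := (hKd (X - t) (by linarith [ht.2])).comp t ((hasDerivAt_id t).const_sub X)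
    have h3 : HasDerivAt (fun t : ℝ => X * t ^ 2 / 2) (X * t) t := by
      refine ((((hasDerivAt_id t).pow 2).const_mul X).div_const 2).congr_deriv ?_
      simp; ring
    have h4 : HasDerivAt (fun t : ℝ => t ^ 3 / 3) (t ^ 2) t := by
      refine (((hasDerivAt_id t).pow 3).div_const 3).congr_deriv ?_
      simp
    refine (((h3.sub h4).add hp).add hm).congr_deriv ?_
    unfold sliceArea
    ring

/-- `sliceArea X` is not monotone, but its derivative is at most `2X`. Subtracting a linear term,
whose sum is explicit, makes the integral comparison available. -/
theorem antitoneOn_sliceArea_sub (X : ℝ) :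
    AntitoneOn (fun t => sliceArea X t - 2 * X * t) (Set.Icc 0 X) := by
  have hd : ∀ t ∈ Set.Ioo 0 X, HasDerivAt (fun t => sliceArea X t - 2 * X * t)
      (-2 * t - t * (Real.log (X + t) - Real.log (X - t))) t := by
    intro t ht
    have hp : HasDerivAt (fun t => (X + t) * Real.log (X + t)) ((Real.log (X + t) + 1) * 1) t :=
      (Real.hasDerivAt_mul_log (by linarith [ht.1, ht.2] : X + t ≠ 0)).comp t
        ((hasDerivAt_id t).const_add X)
    have hm : HasDerivAt (fun t => (X - t) * Real.log (X - t)) ((Real.log (X - t) + 1) * -1) t :=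
      (Real.hasDerivAt_mul_log (by linarith [ht.1, ht.2] : X - t ≠ 0)).comp t
        ((hasDerivAt_id t).const_sub X)
    have h1 := (hasDerivAt_id t).const_add X
    have h2 := (hasDerivAt_id t).const_sub X
    refine ((((hasDerivAt_id t).mul h2).add (((h2.mul hp).sub (h1.mul hm)).div_const 2)).sub
      ((hasDerivAt_id t).const_mul (2 * X))).congr_deriv ?_
    simp only [id]
    ring
  refine antitoneOn_of_deriv_nonpos (convex_Icc _ _) ?_ ?_ ?_
  · exact ((continuous_sliceArea X).sub (continuous_const.mul continuous_id)).continuousOn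
  · rw [interior_Icc]
    exact fun t ht => (hd t ht).differentiableAt.differentiableWithinAt
  · rw [interior_Icc]
    intro t ht
    rw [(hd t ht).deriv]
    have : Real.log (X - t) ≤ Real.log (X + t) :=
      Real.log_le_log (by linarith [ht.2]) (by linarith [ht.1])
    nlinarith [ht.1]

theorem sum_sliceArea_bounds {X : ℝ} (hX : 0 < X) :
    ∑ a ∈ Finset.range (⌊X⌋₊ + 1), sliceArea X a ≤ 2 / 3 * Real.log 2 * X ^ 3 + X ^ 2 ∧
    2 / 3 * Real.log 2 * X ^ 3 - 4 * X ^ 2 ≤ ∑ a ∈ Finset.range (⌊X⌋₊ + 1), sliceArea X a := by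
  set n := ⌊X⌋₊ with hn
  have hnX : (n : ℝ) ≤ X := Nat.floor_le hX.le
  have hXn : X < n + 1 := Nat.lt_floor_add_one X
  have hn0 : (0 : ℝ) ≤ n := Nat.cast_nonneg n
  have hanti : AntitoneOn (fun t => sliceArea X t - 2 * X * t) (Set.Icc ((0 : ℕ) : ℝ) n) :=
    (antitoneOn_sliceArea_sub X).mono (Set.Icc_subset_Icc (by simp) hnX)
  have hi : ∀ u v, IntervalIntegrable (sliceArea X) MeasureTheory.volume u v :=
    fun u v => (continuous_sliceArea X).intervalIntegrable u v
  have h1 := hanti.sum_le_integral_Ico (Nat.zero_le n)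
  have h2 := hanti.integral_le_sum_Ico (Nat.zero_le n)
  have hint : ∫ t in (0 : ℝ)..n, (sliceArea X t - 2 * X * t) =
      (∫ t in (0 : ℝ)..n, sliceArea X t) - X * n ^ 2 := by
    rw [intervalIntegral.integral_sub (hi _ _)
      (Continuous.intervalIntegrable (by fun_prop) _ _),
      intervalIntegral.integral_const_mul, integral_id]
    ring
  have hgauss : ∑ i ∈ Finset.range n, (i : ℝ) = n * (n - 1) / 2 := by
    clear_value n
    clear * -
    induction n with
    | zero => simp
    | succ k ih => rw [Finset.sum_range_succ, ih]; push_cast; ring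
  rw [Nat.cast_zero, hint, Nat.Ico_zero_eq_range, Finset.sum_sub_distrib, ← Finset.mul_sum]
    at h1 h2
  have hsplit := intervalIntegral.integral_add_adjacent_intervals (hi 0 n) (hi n X)
  rw [integral_sliceArea hX] at hsplit
  have htail0 : 0 ≤ ∫ t in (n : ℝ)..X, sliceArea X t :=
    intervalIntegral.integral_nonneg hnX fun t ht => sliceArea_nonneg (hn0.trans ht.1) ht.2
  have htail1 : ∫ t in (n : ℝ)..X, sliceArea X t ≤ 3 * X ^ 2 := by
    calc ∫ t in (n : ℝ)..X, sliceArea X t ≤ ∫ t in (n : ℝ)..X, 3 * X ^ 2 :=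
          intervalIntegral.integral_mono_on hnX (hi _ _) intervalIntegrable_const
            fun t ht => sliceArea_le (hn0.trans ht.1) ht.2
      _ = (X - n) * (3 * X ^ 2) := by rw [intervalIntegral.integral_const, smul_eq_mul]
      _ ≤ 3 * X ^ 2 := by nlinarith [sq_nonneg X]
  have hXn2 : X * n ≤ X ^ 2 := by nlinarith
  constructor
  · rw [Finset.sum_range_succ']
    have h0 : sliceArea X ((0 : ℕ) : ℝ) = 0 := by simp [sliceArea]
    have h3 : ∑ i ∈ Finset.range n, ((i + 1 : ℕ) : ℝ) = n * (n - 1) / 2 + n := by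
      push_cast
      rw [Finset.sum_add_distrib, hgauss]
      simp
    rw [h3] at h1
    rw [h0]
    nlinarith
  · rw [Finset.sum_range_succ]
    have h0 := sliceArea_nonneg hn0 hnX
    rw [hgauss] at h2
    nlinarith

theorem sum_sum_fiberLength_bounds {X : ℝ} (hX : 1 ≤ X) {M : ℕ} (hM : X ≤ M) :
    ∑ a ∈ Finset.range (M + 1), ∑ i ∈ Finset.range M, fiberLength (X ^ 2) a ((i + 1 : ℕ) : ℝ) ≤
      2 / 3 * Real.log 2 * X ^ 3 + X ^ 2 ∧
    2 / 3 * Real.log 2 * X ^ 3 - 8 * X ^ 2 ≤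
      ∑ a ∈ Finset.range (M + 1), ∑ i ∈ Finset.range M,
        fiberLength (X ^ 2) a ((i + 1 : ℕ) : ℝ) := by
  have hX0 : 0 < X := by linarith
  have hle : ⌊X⌋₊ + 1 ≤ M + 1 := by
    have := Nat.floor_le_of_le hM
    omega
  have hn0 : ((⌊X⌋₊ : ℕ) : ℝ) ≤ X := Nat.floor_le hX0.le
  have hle' : ∀ a ∈ Finset.range (⌊X⌋₊ + 1), (a : ℝ) ≤ X := by
    intro a ha
    rw [Finset.mem_range, Nat.lt_succ_iff] at ha
    exact (Nat.le_floor_iff hX0.le).mp ha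
  rw [← Finset.sum_subset (Finset.range_subset_range.mpr hle)]
  · obtain ⟨h1, h2⟩ := sum_sliceArea_bounds hX0
    constructor
    · exact (Finset.sum_le_sum fun a ha =>
        (sum_fiberLength_le (Nat.cast_nonneg a) (hle' a ha) hM).1).trans h1
    · calc 2 / 3 * Real.log 2 * X ^ 3 - 8 * X ^ 2
          ≤ ∑ a ∈ Finset.range (⌊X⌋₊ + 1), sliceArea X a -
            ∑ a ∈ Finset.range (⌊X⌋₊ + 1), 2 * X := by
            rw [Finset.sum_const, Finset.card_range, nsmul_eq_mul]
            push_cast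
            -- The slack of `4 X²` covers `2X (⌊X⌋₊ + 1) ≤ 2X (X + 1)`, where `1 ≤ X` is used.
            nlinarith
        _ ≤ ∑ a ∈ Finset.range (⌊X⌋₊ + 1), (sliceArea X a - 2 * a) := by
            rw [Finset.sum_sub_distrib]
            gcongr with a ha
            exact hle' a ha
        _ ≤ _ := Finset.sum_le_sum fun a ha =>
            (sum_fiberLength_le (Nat.cast_nonneg a) (hle' a ha) hM).2
  · intro a _ ha
    refine Finset.sum_eq_zero fun i _ => ?_
    refine fiberLength_eq_zero (Nat.cast_nonneg a) hX0.le (by positivity) ?_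
    rw [Finset.mem_range, not_lt] at ha
    exact (Nat.lt_of_floor_lt ha).le

theorem sum_card_halfReduced_le_main {x : ℝ} (hx : 1 ≤ x) :
    ∑ d ∈ Finset.Ioc ⌊x⌋₊ ⌊2 * x⌋₊, ((halfReduced d).card : ℝ) ≤
      c₂ / 2 * (x * √x) + 23 * x := by
  set M := ⌈√(2 * x)⌉₊ with hMdef
  have hM : √(2 * x) ≤ M := Nat.le_ceil _
  have hM' : (M : ℝ) < √(2 * x) + 1 := Nat.ceil_lt_add_one (Real.sqrt_nonneg _)
  have hs : √(2 * x) = √2 * √x := Real.sqrt_mul (by norm_num) x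
  have hx2 : √x ^ 2 = x := Real.sq_sqrt (by linarith)
  have h22 : √(2 : ℝ) ^ 2 = 2 := Real.sq_sqrt (by norm_num)
  have h2x2 : √(2 * x) ^ 2 = 2 * x := Real.sq_sqrt (by linarith)
  have hx1 : 1 ≤ √x := Real.one_le_sqrt.mpr hx
  have h2x1 : 1 ≤ √(2 * x) := Real.one_le_sqrt.mpr (by linarith)
  have hxM : √x ≤ M := (Real.sqrt_le_sqrt (by linarith)).trans hM
  have h0 := sum_card_halfReduced_le (by linarith) hM
  have h1 := (sum_sum_fiberLength_bounds h2x1 hM).1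
  have h2 := (sum_sum_fiberLength_bounds hx1 hxM).2
  rw [h2x2] at h1
  rw [hx2] at h2
  have hr2 : √(2 : ℝ) < 1.5 := by
    rw [Real.sqrt_lt' (by norm_num)]; norm_num
  have hcard : ((M : ℝ) + 1) * M ≤ 13 * x := by
    have h3 : (M : ℝ) + 1 ≤ 3.5 * √x := by rw [hs] at hM'; nlinarith
    have h4 : (M : ℝ) ≤ 3.5 * √x := by linarith
    have h5 : (0 : ℝ) ≤ M := Nat.cast_nonneg M
    nlinarith
  have e1 : √(2 * x) ^ 3 = 2 * √2 * (x * √x) := by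
    rw [hs, mul_pow, pow_succ, h22, pow_succ, hx2]
  have e2 : √x ^ 3 = x * √x := by rw [pow_succ, hx2]
  rw [e1] at h1
  rw [e2] at h2
  unfold c₂
  -- The error `23 x` is `2 x` from the upper bound at `√(2x)`, `8 x` from the lower bound at `√x`,
  -- and `13 x` from rounding.
  linarith

/-! ### The second moment -/

theorem card_mul_le_of_modEq {S : Finset ℕ} {N L : ℕ} (hN : L ∣ N) (hS : S ⊆ Finset.range N)
    (hmod : ∀ d ∈ S, ∀ e ∈ S, d ≡ e [MOD L]) : S.card * L ≤ N := by
  have hcard : S.card ≤ (Finset.range (N / L)).card := by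
    refine Finset.card_le_card_of_injOn (fun d => d / L) ?_ ?_
    · intro d hd
      have := Finset.mem_range.mp (hS hd)
      rw [Finset.coe_range, Set.mem_Iio]
      exact Nat.div_lt_div_of_lt_of_dvd hN this
    · intro d hd e he hde
      rw [← Nat.div_add_mod d L, ← Nat.div_add_mod e L, hmod d hd e he]
      dsimp only at hde
      rw [hde]
  rw [Finset.card_range] at hcard
  exact (Nat.mul_le_mul_right L hcard).trans (Nat.div_mul_le_self N L)

theorem card_filter_dvd_two_mul_le {b h : ℕ} (hh : h ∣ b) :
    ((Finset.range b).filter fun i => h ∣ 2 * i).card * h ≤ 2 * b := by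
  rcases Nat.eq_zero_or_pos h with rfl | hpos
  · simp
  have hg : 0 < h.gcd 2 := Nat.gcd_pos_of_pos_left _ hpos
  have hg2 : h.gcd 2 ≤ 2 := Nat.gcd_le_right _ two_pos
  have hdiv : h / h.gcd 2 * h.gcd 2 = h := Nat.div_mul_cancel (Nat.gcd_dvd_left h 2)
  have key := card_mul_le_of_modEq (S := (Finset.range b).filter fun i => h ∣ 2 * i)
    (N := b) (L := h / h.gcd 2) ((Nat.div_dvd_of_dvd (Nat.gcd_dvd_left h 2)).trans hh)
    (Finset.filter_subset _ _) ?_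
  · calc _ = ((Finset.range b).filter fun i => h ∣ 2 * i).card * (h / h.gcd 2) * h.gcd 2 := by
          rw [mul_assoc, hdiv]
      _ ≤ b * 2 := Nat.mul_le_mul key hg2
      _ = 2 * b := mul_comm _ _
  · have hz : ∀ i ∈ (Finset.range b).filter (fun i => h ∣ 2 * i), i ≡ 0 [MOD h / h.gcd 2] := by
      intro i hi
      rw [Nat.modEq_zero_iff_dvd]
      have h1 := (Finset.mem_filter.mp hi).2
      have h2 : h / h.gcd 2 ∣ 2 / h.gcd 2 * i := by
        rw [← Nat.mul_dvd_mul_iff_right hg, hdiv]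
        have : 2 / h.gcd 2 * i * h.gcd 2 = 2 * i := by
          rw [mul_right_comm, Nat.div_mul_cancel (Nat.gcd_dvd_right h 2)]
        rwa [this]
      exact (Nat.coprime_div_gcd_div_gcd hg).dvd_of_dvd_mul_left h2
    exact fun i hi j hj => (hz i hi).trans (hz j hj).symm

/-- The two conditions force `gcd(e, f) ∣ 2i`, and given `i` they fix `j` mod `lcm(e, f)`; the
moduli multiply to `e * f`. -/
theorem card_filter_dvd_sub_dvd_add_le {b b' e f : ℕ} (hb : e * f ∣ b)
    (hb' : e * f ∣ b') :
    ((Finset.range b ×ˢ Finset.range b').filter fun p =>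
      (e : ℤ) ∣ p.1 - p.2 ∧ (f : ℤ) ∣ p.1 + p.2).card * (e * f) ≤ 2 * b * b' := by
  set G := (Finset.range b).filter fun i => e.gcd f ∣ 2 * i with hG
  have hle : ((Finset.range b ×ˢ Finset.range b').filter fun p =>
      (e : ℤ) ∣ p.1 - p.2 ∧ (f : ℤ) ∣ p.1 + p.2).card ≤
      ∑ i ∈ G, ((Finset.range b').filter fun j : ℕ =>
        (e : ℤ) ∣ (i : ℤ) - (j : ℤ) ∧ (f : ℤ) ∣ (i : ℤ) + (j : ℤ)).card := by
    rw [← Finset.card_sigma]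
    refine Finset.card_le_card_of_injOn (fun p => ⟨p.1, p.2⟩) ?_ ?_
    · rintro ⟨i, j⟩ hp
      simp only [Finset.coe_filter, Set.mem_ofPred_eq, Finset.mem_product, Finset.mem_range] at hp
      obtain ⟨⟨hi, hj⟩, h1, h2⟩ := hp
      rw [Finset.mem_coe, Finset.mem_sigma, hG, Finset.mem_filter, Finset.mem_filter,
        Finset.mem_range, Finset.mem_range]
      refine ⟨⟨hi, ?_⟩, hj, h1, h2⟩
      have h3 : ((e.gcd f : ℕ) : ℤ) ∣ ((i : ℤ) - j) + (i + j) :=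
        dvd_add ((Int.natCast_dvd_natCast.mpr (Nat.gcd_dvd_left e f)).trans h1)
          ((Int.natCast_dvd_natCast.mpr (Nat.gcd_dvd_right e f)).trans h2)
      rw [show ((i : ℤ) - j) + (i + j) = ((2 * i : ℕ) : ℤ) by push_cast; ring] at h3
      exact Int.natCast_dvd_natCast.mp h3
    · rintro ⟨i, j⟩ _ ⟨i', j'⟩ _ h
      simpa using h
  have hfib : ∀ i ∈ G, ((Finset.range b').filter fun j : ℕ =>
      (e : ℤ) ∣ (i : ℤ) - (j : ℤ) ∧ (f : ℤ) ∣ (i : ℤ) + (j : ℤ)).card * e.lcm f ≤ b' := by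
    intro i _
    refine card_mul_le_of_modEq ((Nat.lcm_dvd_mul e f).trans hb') (Finset.filter_subset _ _) ?_
    intro j hj k hk
    obtain ⟨-, h1, h2⟩ := Finset.mem_filter.mp hj
    obtain ⟨-, h3, h4⟩ := Finset.mem_filter.mp hk
    refine Nat.mod_lcm (Nat.modEq_iff_dvd.mpr ?_) (Nat.modEq_iff_dvd.mpr ?_)
    · convert! dvd_sub h1 h3 using 1; ring
    · convert! dvd_sub h4 h2 using 1; ring
  calc _ ≤ (∑ i ∈ G, ((Finset.range b').filter fun j : ℕ =>
        (e : ℤ) ∣ (i : ℤ) - (j : ℤ) ∧ (f : ℤ) ∣ (i : ℤ) + (j : ℤ)).card) * (e * f) :=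
        Nat.mul_le_mul_right _ hle
    _ = (∑ i ∈ G, ((Finset.range b').filter fun j : ℕ =>
        (e : ℤ) ∣ (i : ℤ) - (j : ℤ) ∧ (f : ℤ) ∣ (i : ℤ) + (j : ℤ)).card * e.lcm f) * e.gcd f := by
        rw [← Finset.sum_mul, mul_assoc, mul_comm (e.lcm f), Nat.gcd_mul_lcm]
    _ ≤ (∑ _i ∈ G, b') * e.gcd f := Nat.mul_le_mul_right _ (Finset.sum_le_sum hfib)
    _ = G.card * e.gcd f * b' := by rw [Finset.sum_const, smul_eq_mul]; ring
    _ ≤ 2 * b * b' := Nat.mul_le_mul_right _ (card_filter_dvd_two_mul_le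
        ((Nat.gcd_dvd_left e f).trans ((dvd_mul_right e f).trans hb)))

/-- If `g ∣ (i - j)(i + j)`, then `e = gcd(i - j, g)` satisfies `e ∣ i - j` and `g / e ∣ i + j`; sum
over the divisors `e`. -/
theorem card_sq_modEq_sq_mul_le {b b' g : ℕ} (hg : 0 < g) (hb : g ∣ b) (hb' : g ∣ b') :
    ((Finset.range b ×ˢ Finset.range b').filter fun p => p.1 ^ 2 ≡ p.2 ^ 2 [MOD g]).card * g ≤
      2 * b * b' * g.divisors.card := by
  have hsub : ((Finset.range b ×ˢ Finset.range b').filter fun p => p.1 ^ 2 ≡ p.2 ^ 2 [MOD g]) ⊆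
      g.divisors.biUnion fun e => (Finset.range b ×ˢ Finset.range b').filter fun p =>
        (e : ℤ) ∣ p.1 - p.2 ∧ ((g / e : ℕ) : ℤ) ∣ p.1 + p.2 := by
    rintro ⟨i, j⟩ hp
    obtain ⟨hp1, hp2⟩ := Finset.mem_filter.mp hp
    rw [Finset.mem_biUnion]
    refine ⟨Int.gcd ((i : ℤ) - j) g, Nat.mem_divisors.mpr ⟨?_, hg.ne'⟩,
      Finset.mem_filter.mpr ⟨hp1, Int.gcd_dvd_left _ _, ?_⟩⟩
    · exact Int.natCast_dvd_natCast.mp (Int.gcd_dvd_right _ _)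
    · have h1 : (g : ℤ) ∣ ((i : ℤ) - j) * (i + j) := by
        have := (Nat.modEq_iff_dvd.mp hp2.symm)
        push_cast at this
        convert! this using 1
        ring
      set c := Int.gcd ((i : ℤ) - j) g with hc
      have hc0 : 0 < c := Int.gcd_pos_of_ne_zero_right _ (by exact_mod_cast hg.ne')
      obtain ⟨u, hu⟩ : (c : ℤ) ∣ (i : ℤ) - j := Int.gcd_dvd_left _ _
      obtain ⟨v, hv⟩ : (c : ℤ) ∣ (g : ℤ) := Int.gcd_dvd_right _ _
      have hcz : (c : ℤ) ≠ 0 := by exact_mod_cast hc0.ne'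
      have hcop : IsCoprime u v := by
        rw [Int.isCoprime_iff_gcd_eq_one]
        have h2 : c = c * Int.gcd u v := by
          conv_lhs => rw [hc, hu, hv, Int.gcd_mul_left]
          simp
        exact (Nat.eq_of_mul_eq_mul_left hc0 (by rw [mul_one]; exact h2)).symm
      have hge : ((g / c : ℕ) : ℤ) = v := by
        rw [Int.natCast_div, hv, Int.mul_ediv_cancel_left _ hcz]
      rw [hge]
      rw [hu, hv, mul_assoc] at h1
      exact hcop.symm.dvd_of_dvd_mul_left (Int.dvd_of_mul_dvd_mul_left hcz h1)
  calc _ ≤ (∑ e ∈ g.divisors, ((Finset.range b ×ˢ Finset.range b').filter fun p =>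
        (e : ℤ) ∣ p.1 - p.2 ∧ ((g / e : ℕ) : ℤ) ∣ p.1 + p.2).card) * g :=
        Nat.mul_le_mul_right _ ((Finset.card_le_card hsub).trans Finset.card_biUnion_le)
    _ ≤ ∑ _e ∈ g.divisors, 2 * b * b' := by
        rw [Finset.sum_mul]
        refine Finset.sum_le_sum fun e he => ?_
        have heg : e ∣ g := Nat.dvd_of_mem_divisors he
        have hmul : e * (g / e) = g := Nat.mul_div_cancel' heg
        have := card_filter_dvd_sub_dvd_add_le (b := b) (b' := b') (e := e) (f := g / e)
          (by rwa [hmul]) (by rwa [hmul])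
        rwa [hmul] at this
    _ = _ := by rw [Finset.sum_const, smul_eq_mul, mul_comm]

/-- The number of square roots of `d` modulo `b`. -/
def numSqrtsMod (d b : ℕ) : ℕ := ((Finset.range b).filter fun i => d ≡ i ^ 2 [MOD b]).card

/-- For fixed `b` the admissible `a` satisfy `√d - b < a ≤ √(d - b²)`, an interval of length less
than `b`, so `a` is determined by its residue mod `b`. -/
theorem card_halfReduced_le_sum_numSqrtsMod {d B : ℕ} (hB : d < (B + 1) ^ 2) :
    (halfReduced d).card ≤ ∑ b ∈ Finset.Icc 1 B, numSqrtsMod d b := by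
  unfold numSqrtsMod
  rw [← Finset.card_sigma]
  refine Finset.card_le_card_of_injOn (fun p => ⟨p.2, p.1 % p.2⟩) ?_ ?_
  · rintro ⟨a, b⟩ hp
    obtain ⟨hb, h1, -, h2⟩ := mem_halfReduced.mp hp
    rw [Finset.mem_coe, Finset.mem_sigma, Finset.mem_Icc, Finset.mem_filter, Finset.mem_range]
    refine ⟨⟨hb, ?_⟩, Nat.mod_lt _ hb, h2.trans ((Nat.mod_modEq a b).pow 2).symm⟩
    dsimp only
    by_contra! h
    nlinarith
  · rintro ⟨a, b⟩ hp ⟨a', b'⟩ hp' heq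
    simp only [Sigma.mk.injEq] at heq
    obtain ⟨rfl, heq⟩ := heq
    have hmod : a ≡ a' [MOD b] := eq_of_heq heq
    obtain ⟨hb, h1, h2, -⟩ := mem_halfReduced.mp hp
    obtain ⟨-, h1', h2', -⟩ := mem_halfReduced.mp hp'
    suffices a = a' by rw [this]
    rcases lt_trichotomy a a' with h | h | h
    · have := hmod.add_le_of_lt h
      nlinarith
    · exact h
    · have := hmod.symm.add_le_of_lt h
      nlinarith

/-- Roots `i` mod `b` and `j` mod `b'` of the same `d` satisfy `i² ≡ j²` mod the gcd, and they place
`d` in one class mod the lcm, with at most `x / lcm + 1` members. -/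
theorem sum_numSqrtsMod_mul_le {x : ℝ} (hx : 0 ≤ x) {b b' : ℕ} (hb : 0 < b) (hb' : 0 < b') :
    ∑ d ∈ Finset.Ioc ⌊x⌋₊ ⌊2 * x⌋₊, (numSqrtsMod d b : ℝ) * numSqrtsMod d b' ≤
      2 * x * (b.gcd b').divisors.card + 2 * (b * b') := by
  set I := Finset.Ioc ⌊x⌋₊ ⌊2 * x⌋₊ with hI
  set g := b.gcd b' with hg
  have hg0 : 0 < g := Nat.gcd_pos_of_pos_left _ hb
  set t := Finset.range b ×ˢ Finset.range b' with ht
  set Pr := t.filter fun p => p.1 ^ 2 ≡ p.2 ^ 2 [MOD g] with hPr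
  have hL0 : 0 < b.lcm b' := Nat.lcm_pos hb hb'
  have h1 : ∑ d ∈ I, numSqrtsMod d b * numSqrtsMod d b' =
      ∑ p ∈ t, (I.filter fun d => d ≡ p.1 ^ 2 [MOD b] ∧ d ≡ p.2 ^ 2 [MOD b']).card := by
    refine Eq.trans ?_ (Finset.sum_card_bipartiteAbove_eq_sum_card_bipartiteBelow
      (fun d (p : ℕ × ℕ) => d ≡ p.1 ^ 2 [MOD b] ∧ d ≡ p.2 ^ 2 [MOD b']))
    refine Finset.sum_congr rfl fun d _ => ?_
    unfold numSqrtsMod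
    rw [← Finset.card_product, ← Finset.filter_product]
    rfl
  have h2 : ∑ p ∈ t, (I.filter fun d => d ≡ p.1 ^ 2 [MOD b] ∧ d ≡ p.2 ^ 2 [MOD b']).card =
      ∑ p ∈ Pr, (I.filter fun d => d ≡ p.1 ^ 2 [MOD b] ∧ d ≡ p.2 ^ 2 [MOD b']).card := by
    refine (Finset.sum_subset (Finset.filter_subset _ _) fun p hp hpn => ?_).symm
    rw [Finset.card_eq_zero, Finset.filter_eq_empty_iff]
    rintro d - ⟨h3, h4⟩
    exact hpn (Finset.mem_filter.mpr ⟨hp, (h3.symm.of_dvd (Nat.gcd_dvd_left b b')).trans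
      (h4.of_dvd (Nat.gcd_dvd_right b b'))⟩)
  have h3 : ∀ p ∈ Pr, (((I.filter fun d => d ≡ p.1 ^ 2 [MOD b] ∧ d ≡ p.2 ^ 2 [MOD b']).card : ℕ)
      : ℝ) ≤ x / (b.lcm b' : ℕ) + 1 := by
    intro p _
    have := card_le_of_modEq (S := I.filter fun d => d ≡ p.1 ^ 2 [MOD b] ∧ d ≡ p.2 ^ 2 [MOD b'])
      hL0 (l := x) (h := 2 * x) (by linarith) ?_ ?_
    · rwa [show 2 * x - x = x by ring] at this
    · intro d hd
      obtain ⟨h4, h5⟩ := Finset.mem_Ioc.mp (Finset.mem_filter.mp hd).1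
      exact ⟨((Nat.floor_lt hx).mp h4).le, (Nat.le_floor_iff (by linarith)).mp h5⟩
    · intro d hd e he
      obtain ⟨-, h4, h5⟩ := Finset.mem_filter.mp hd
      obtain ⟨-, h6, h7⟩ := Finset.mem_filter.mp he
      exact Nat.mod_lcm (h4.trans h6.symm) (h5.trans h7.symm)
  have hcard : (Pr.card : ℝ) * g ≤ 2 * b * b' * g.divisors.card := by
    exact_mod_cast card_sq_modEq_sq_mul_le hg0 (Nat.gcd_dvd_left b b') (Nat.gcd_dvd_right b b')
  have hgr : (0 : ℝ) < g := by exact_mod_cast hg0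
  have hLr : (0 : ℝ) < (b.lcm b' : ℕ) := by exact_mod_cast hL0
  have hgL : (g : ℝ) * (b.lcm b' : ℕ) = b * b' := by exact_mod_cast Nat.gcd_mul_lcm b b'
  have hdiv : (g.divisors.card : ℝ) ≤ g := by exact_mod_cast Nat.card_divisors_le_self g
  have hbr : (0 : ℝ) ≤ b * b' := by positivity
  calc ∑ d ∈ I, (numSqrtsMod d b : ℝ) * numSqrtsMod d b'
      = ∑ p ∈ Pr, (((I.filter fun d => d ≡ p.1 ^ 2 [MOD b] ∧ d ≡ p.2 ^ 2 [MOD b']).card : ℕ)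
        : ℝ) := by exact_mod_cast h1.trans h2
    _ ≤ ∑ _p ∈ Pr, (x / (b.lcm b' : ℕ) + 1) := Finset.sum_le_sum h3
    _ = Pr.card * (x / (b.lcm b' : ℕ)) + Pr.card := by
        rw [Finset.sum_const, nsmul_eq_mul]; ring
    _ ≤ _ := by
        refine add_le_add ?_ ?_
        · rw [← mul_div_assoc, div_le_iff₀ hLr]
          refine le_of_mul_le_mul_right ?_ hgr
          calc (Pr.card : ℝ) * x * g = x * (Pr.card * g) := by ring
            _ ≤ x * (2 * b * b' * g.divisors.card) := by gcongr
            _ = 2 * x * g.divisors.card * (b * b') := by ring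
            _ = _ := by rw [← hgL]; ring
        · refine le_of_mul_le_mul_right (hcard.trans ?_) hgr
          calc 2 * (b : ℝ) * b' * g.divisors.card = 2 * (b * b') * g.divisors.card := by ring
            _ ≤ 2 * (b * b') * g := by gcongr

/-- Counting common divisors `e` first gives the sum of `⌊B / e⌋²`, at most `ζ(2) B²`. -/
theorem sum_card_divisors_gcd_le (B : ℕ) :
    ∑ b ∈ Finset.Icc 1 B, ∑ b' ∈ Finset.Icc 1 B, ((b.gcd b').divisors.card : ℝ) ≤
      1.65 * (B : ℝ) ^ 2 := by
  have h1 : ∀ b ∈ Finset.Icc 1 B, ∀ b' ∈ Finset.Icc 1 B, (b.gcd b').divisors.card =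
      ∑ e ∈ Finset.Icc 1 B, (if e ∣ b then 1 else 0) * (if e ∣ b' then 1 else 0) := by
    intro b hb b' hb'
    rw [Finset.mem_Icc] at hb hb'
    simp_rw [ite_zero_mul_ite_zero, mul_one]
    rw [← Finset.card_filter]
    congr 1
    ext e
    simp only [Nat.mem_divisors, Nat.dvd_gcd_iff, Finset.mem_filter, Finset.mem_Icc]
    constructor
    · rintro ⟨⟨h2, h3⟩, -⟩
      have := Nat.le_of_dvd (by omega) h2
      have := Nat.pos_of_dvd_of_pos h2 (by omega)
      exact ⟨⟨by omega, by omega⟩, h2, h3⟩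
    · rintro ⟨-, h2, h3⟩
      exact ⟨⟨h2, h3⟩, (Nat.gcd_pos_of_pos_left _ (by omega)).ne'⟩
  have h2 : ∑ b ∈ Finset.Icc 1 B, ∑ b' ∈ Finset.Icc 1 B, (b.gcd b').divisors.card =
      ∑ e ∈ Finset.Icc 1 B, (B / e) ^ 2 := by
    rw [Finset.sum_congr rfl fun b hb => Finset.sum_congr rfl (h1 b hb)]
    rw [Finset.sum_congr rfl fun b _ => Finset.sum_comm, Finset.sum_comm]
    refine Finset.sum_congr rfl fun e _ => ?_
    rw [← Finset.sum_mul_sum, ← sq, ← Finset.card_filter]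
    congr 1
    exact Nat.Ioc_filter_dvd_card_eq_div B e
  calc ∑ b ∈ Finset.Icc 1 B, ∑ b' ∈ Finset.Icc 1 B, ((b.gcd b').divisors.card : ℝ)
      = ∑ e ∈ Finset.Icc 1 B, ((B / e : ℕ) : ℝ) ^ 2 := by exact_mod_cast h2
    _ ≤ ∑ e ∈ Finset.Icc 1 B, (B : ℝ) ^ 2 * (1 / (e : ℝ) ^ 2) := by
        refine Finset.sum_le_sum fun e _ => ?_
        rw [mul_one_div, ← div_pow]
        gcongr
        exact Nat.cast_div_le
    _ = (B : ℝ) ^ 2 * ∑ e ∈ Finset.Icc 1 B, 1 / (e : ℝ) ^ 2 := by rw [Finset.mul_sum]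
    _ ≤ (B : ℝ) ^ 2 * (Real.pi ^ 2 / 6) := by
        gcongr
        exact sum_le_hasSum _ (fun e _ => by positivity) hasSum_zeta_two
    _ ≤ 1.65 * (B : ℝ) ^ 2 := by
        have : Real.pi ^ 2 / 6 ≤ 1.65 := by
          have := Real.pi_lt_d4
          have := Real.pi_pos
          nlinarith
        rw [mul_comm]
        gcongr

theorem sum_sq_card_halfReduced_le {x : ℝ} (hx : 1 ≤ x) :
    ∑ d ∈ Finset.Ioc ⌊x⌋₊ ⌊2 * x⌋₊, ((halfReduced d).card : ℝ) ^ 2 ≤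
      47 / 4 * x ^ 2 + 4 * (x * √x) := by
  set B := ⌊√(2 * x)⌋₊ with hBdef
  have hB : (B : ℝ) ≤ √(2 * x) := Nat.floor_le (Real.sqrt_nonneg _)
  have hs : √(2 * x) = √2 * √x := Real.sqrt_mul (by norm_num) x
  have hx2 : √x ^ 2 = x := Real.sq_sqrt (by linarith)
  have h2x2 : √(2 * x) ^ 2 = 2 * x := Real.sq_sqrt (by linarith)
  have hx1 : 1 ≤ √x := Real.one_le_sqrt.mpr hx
  have hr2 : √(2 : ℝ) < 1.5 := by
    rw [Real.sqrt_lt' (by norm_num)]; norm_num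
  have hB0 : (0 : ℝ) ≤ B := Nat.cast_nonneg B
  have hB2 : (B : ℝ) ^ 2 ≤ 2 * x := by rw [← h2x2]; gcongr
  have hB1 : (B : ℝ) ≤ 1.5 * √x := by nlinarith
  have hdB : ∀ d ∈ Finset.Ioc ⌊x⌋₊ ⌊2 * x⌋₊, d < (B + 1) ^ 2 := by
    intro d hd
    have h1 : (d : ℝ) ≤ 2 * x := (Nat.le_floor_iff (by linarith)).mp (Finset.mem_Ioc.mp hd).2
    have h2 : √(2 * x) < B + 1 := Nat.lt_floor_add_one _
    have h3 : (d : ℝ) < ((B : ℝ) + 1) ^ 2 := by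
      have := Real.sqrt_nonneg (2 * x)
      nlinarith
    exact_mod_cast h3
  have hsum : ∑ b ∈ Finset.Icc 1 B, (b : ℝ) = B * (B + 1) / 2 := by
    clear_value B
    clear * -
    induction B with
    | zero => simp
    | succ k ih => rw [Finset.sum_Icc_succ_top (by omega), ih]; push_cast; ring
  calc ∑ d ∈ Finset.Ioc ⌊x⌋₊ ⌊2 * x⌋₊, ((halfReduced d).card : ℝ) ^ 2
      ≤ ∑ d ∈ Finset.Ioc ⌊x⌋₊ ⌊2 * x⌋₊, (∑ b ∈ Finset.Icc 1 B, (numSqrtsMod d b : ℝ)) ^ 2 := by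
        refine Finset.sum_le_sum fun d hd => ?_
        gcongr
        exact_mod_cast card_halfReduced_le_sum_numSqrtsMod (hdB d hd)
    _ = ∑ b ∈ Finset.Icc 1 B, ∑ b' ∈ Finset.Icc 1 B, ∑ d ∈ Finset.Ioc ⌊x⌋₊ ⌊2 * x⌋₊,
          (numSqrtsMod d b : ℝ) * numSqrtsMod d b' := by
        simp_rw [sq, Finset.sum_mul_sum]
        rw [Finset.sum_comm]
        exact Finset.sum_congr rfl fun b _ => Finset.sum_comm
    _ ≤ ∑ b ∈ Finset.Icc 1 B, ∑ b' ∈ Finset.Icc 1 B,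
          (2 * x * (b.gcd b').divisors.card + 2 * ((b : ℝ) * b')) := by
        refine Finset.sum_le_sum fun b hb => Finset.sum_le_sum fun b' hb' => ?_
        exact sum_numSqrtsMod_mul_le (by linarith) (Finset.mem_Icc.mp hb).1
          (Finset.mem_Icc.mp hb').1
    _ = 2 * x * (∑ b ∈ Finset.Icc 1 B, ∑ b' ∈ Finset.Icc 1 B, ((b.gcd b').divisors.card : ℝ)) +
          2 * ((B * (B + 1) / 2) * (B * (B + 1) / 2)) := by
        rw [← hsum, Finset.sum_mul_sum]
        simp_rw [Finset.sum_add_distrib, Finset.mul_sum]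
    _ ≤ 2 * x * (1.65 * (B : ℝ) ^ 2) + 2 * ((B * (B + 1) / 2) * (B * (B + 1) / 2)) := by
        gcongr
        exact sum_card_divisors_gcd_le B
    _ = 3.3 * x * (B : ℝ) ^ 2 + (B : ℝ) ^ 2 * ((B : ℝ) ^ 2 + 2 * B + 1) / 2 := by ring
    _ ≤ 3.3 * x * (2 * x) + (2 * x) * (2 * x + 2 * (1.5 * √x) + 1) / 2 := by gcongr
    -- The left side is `8.6 x² + 3 x√x + x`, and `x ≤ x²`.
    _ ≤ 47 / 4 * x ^ 2 + 4 * (x * √x) := by nlinarith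

/-! ### Markov's inequality -/

theorem ncard_D_mul_le {x α : ℝ} (hx : 0 ≤ x) (hα : 0 < α) (k : ℕ) :
    ((D x α).ncard : ℝ) * (α * √x) ^ k ≤ ∑ d ∈ Finset.Ioc ⌊x⌋₊ ⌊2 * x⌋₊, (T d : ℝ) ^ k := by
  classical
  set S := (Finset.Ioc ⌊x⌋₊ ⌊2 * x⌋₊).filter fun d : ℕ => α * √(d : ℝ) < T d with hS
  have hDS : D x α = S := by
    ext d
    rw [hS, Finset.coe_filter]
    simp only [D, Set.mem_ofPred_eq, Finset.mem_Ioc, Nat.floor_lt hx,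
      Nat.le_floor_iff (show 0 ≤ 2 * x by linarith), and_assoc]
  rw [hDS, Set.ncard_coe_finset, ← nsmul_eq_mul, ← Finset.sum_const]
  refine (Finset.sum_le_sum fun d hd => ?_).trans
    (Finset.sum_le_sum_of_subset_of_nonneg (Finset.filter_subset _ _) fun d _ _ => by positivity)
  obtain ⟨h1, h2⟩ := Finset.mem_filter.mp hd
  have h3 : x ≤ d := ((Nat.floor_lt hx).mp (Finset.mem_Ioc.mp h1).1).le
  have h4 : α * √x ≤ α * √d := by gcongr
  have h5 : 0 ≤ α * √x := by positivity
  exact pow_le_pow_left₀ h5 (h4.trans h2.le) k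

theorem tendsto_const_div_sqrt_atTop (c : ℝ) : Tendsto (fun x : ℝ => c / √x) atTop (𝓝 0) :=
  tendsto_const_nhds.div_atTop Real.tendsto_sqrt_atTop

theorem c₂_bounds : (1.6898 : ℝ) ≤ c₂ ∧ c₂ < (1.6899 : ℝ) := by
  have h1 : (1.41421 : ℝ) ≤ √2 := Real.le_sqrt_of_sq_le (by norm_num)
  have h2 : √2 ≤ (1.41422 : ℝ) := Real.sqrt_le_iff.mpr (by norm_num)
  have h3 := Real.log_two_gt_d9
  have h4 := Real.log_two_lt_d9
  unfold c₂
  constructor <;> nlinarith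

end SqrtPeriod

theorem corollary2 :
    ((1.6898 : ℝ) ≤ SqrtPeriod.c₂ ∧ SqrtPeriod.c₂ < (1.6899 : ℝ)) ∧
    (∃ ε : ℝ → ℝ, Tendsto ε atTop (𝓝 0) ∧
      ∀ α : ℝ, 0 < α → ∀ x : ℝ, 1 < x →
        ((SqrtPeriod.D x α).ncard : ℝ) ≤ (SqrtPeriod.c₂ + ε x) / α * x) ∧
    (∃ ε : ℝ → ℝ, Tendsto ε atTop (𝓝 0) ∧
      ∀ α : ℝ, 0 < α → ∀ x : ℝ, 1 < x →
        ((SqrtPeriod.D x α).ncard : ℝ) ≤ (47 + ε x) / α ^ 2 * x) := by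
  refine ⟨SqrtPeriod.c₂_bounds,
    ⟨fun x => 46 / √x, SqrtPeriod.tendsto_const_div_sqrt_atTop 46, fun α hα x hx => ?_⟩,
    ⟨fun x => 16 / √x, SqrtPeriod.tendsto_const_div_sqrt_atTop 16, fun α hα x hx => ?_⟩⟩
  · have hs : 0 < √x := Real.sqrt_pos.mpr (by linarith)
    have hx2 : √x ^ 2 = x := Real.sq_sqrt (by linarith)
    have h1 := SqrtPeriod.ncard_D_mul_le (by linarith : 0 ≤ x) hα 1
    simp_rw [pow_one] at h1
    have h2 : ∑ d ∈ Finset.Ioc ⌊x⌋₊ ⌊2 * x⌋₊, (SqrtPeriod.T d : ℝ) ≤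
        ∑ d ∈ Finset.Ioc ⌊x⌋₊ ⌊2 * x⌋₊, 2 * ((SqrtPeriod.halfReduced d).card : ℝ) :=
      Finset.sum_le_sum fun d _ => by
        exact_mod_cast SqrtPeriod.T_le_two_mul_card_halfReduced d
    rw [← Finset.mul_sum] at h2
    have h3 := SqrtPeriod.sum_card_halfReduced_le_main hx.le
    refine le_of_mul_le_mul_right ?_ (mul_pos hα hs)
    calc _ ≤ SqrtPeriod.c₂ * (x * √x) + 46 * x := by linarith
      _ = _ := by field_simp
  · have hs : 0 < √x := Real.sqrt_pos.mpr (by linarith)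
    have hx2 : √x ^ 2 = x := Real.sq_sqrt (by linarith)
    have h1 := SqrtPeriod.ncard_D_mul_le (by linarith : 0 ≤ x) hα 2
    have h2 : ∑ d ∈ Finset.Ioc ⌊x⌋₊ ⌊2 * x⌋₊, (SqrtPeriod.T d : ℝ) ^ 2 ≤
        ∑ d ∈ Finset.Ioc ⌊x⌋₊ ⌊2 * x⌋₊, 4 * ((SqrtPeriod.halfReduced d).card : ℝ) ^ 2 := by
      refine Finset.sum_le_sum fun d _ => ?_
      have h : (SqrtPeriod.T d : ℝ) ≤ 2 * ((SqrtPeriod.halfReduced d).card : ℝ) := by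
        exact_mod_cast SqrtPeriod.T_le_two_mul_card_halfReduced d
      calc (SqrtPeriod.T d : ℝ) ^ 2 ≤ (2 * ((SqrtPeriod.halfReduced d).card : ℝ)) ^ 2 := by gcongr
        _ = _ := by ring
    rw [← Finset.mul_sum] at h2
    have h3 := SqrtPeriod.sum_sq_card_halfReduced_le hx.le
    refine le_of_mul_le_mul_right ?_ (pow_pos (mul_pos hα hs) 2)
    calc _ ≤ 47 * x ^ 2 + 16 * (x * √x) := by linarith
      _ = _ := by
        rw [mul_pow, hx2]
        field_simp
        linear_combination 16 * hx2
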